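/- For integers $k\ge 1$ and $n\ge 0$ let $c\phi_k(n)$ be the number of generalized Frobenius partitions of $n$ in $k$ colors, that is, of two-rowed arrays $$\begin{pmatrix} a_1 & a_2 & \cdots & a_m\\ b_1 & b_2 & \cdots & b_m\end{pmatrix},\qquad m\ge 0,$$ whose rows are strictly decreasing sequences of elements of $k$ copies of the nonnegative integers (where $r$ in the $j$th copy is smaller than $s$ in the $l$th copy precisely when $r<s$, or $r=s$ and $j<l$) and which satisfy $n=m+\sum_{j=1}^m(a_j+b_j)$, the sum being that of the underlying integers. Let $C\Phi_k(q)=\sum_{n\ge 0}c\phi_k(n)q^n$. For $\tau$ in the complex upper half plane put $q^r=e^{2\pi i r\tau}$ for $r\in\mathbb{Q}$, $\eta(\tau)=q^{1/24}\prod_{n\ge 1}(1-q^n)$, and $\theta_{m,a}(\tau)=\sum_{n\in\mathbb{Z}}q^{(2mn+a)^2/(4m)}$ for integers $m\ge 1$ and $a$. **Proposition.** For every $\tau$ in the upper half plane the series $C\Phi_6(q)$ converges, and $$C\Phi_6(q)=\frac{q^{1/4}}{\eta(\tau)^6}\Big(6\,\theta_{1,1}(\tau)^2\,\theta_{1,0}(\tau)\,\theta_{2,1}(3\tau)\,\theta_{2,1}(\tau)+\theta_{1,0}(\tau)^3\big(\theta_{1,1}(6\tau)\theta_{1,1}(2\tau)+\theta_{1,0}(6\tau)\theta_{1,0}(2\tau)\big)\Big).$$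 -/

import Mathlib

namespace FPartition

/-- `k` copies of the nonnegative integers: `toLex (m, j)` is the integer `m` in the `j`-th copy.
The order is the lexicographic one: `m_j < n_l` iff `m < n`, or `m = n` and `j < l`. -/
abbrev Part (k : ℕ) : Type := ℕ ×ₗ Fin k

/-- The nonnegative integer underlying a colored integer. -/
def Part.val {k : ℕ} (x : Part k) : ℕ := (ofLex x).1

/-- A generalized Frobenius partition of `n` in `k` colors: two rows `a_1 > ... > a_m` and
`b_1 > ... > b_m` of the same length `m`, strictly decreasing, with entries in `k` copies of the
nonnegative integers, such that `n = m + ∑ (a_j + b_j)`. -/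
@[ext] structure ColoredFPartition (k n : ℕ) where
  top : List (Part k)
  bot : List (Part k)
  top_decreasing : top.Pairwise (fun x y => x > y)
  bot_decreasing : bot.Pairwise (fun x y => x > y)
  length_eq : top.length = bot.length
  size_eq : n = top.length + ((top.map Part.val).sum + (bot.map Part.val).sum)

/-- `cφ_k(n)`, the number of generalized Frobenius partitions of `n` in `k` colors. -/
noncomputable def cphi (k n : ℕ) : ℕ := Nat.card (ColoredFPartition k n)

/-- There are only finitely many such partitions, so `cphi` is a genuine count. -/
instance finite_coloredFPartition (k n : ℕ) : Finite (ColoredFPartition k n) := by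
  let S : Set (List (Part k)) := {l | l.length ≤ n ∧ (l.map Part.val).sum ≤ n}
  have hS : S.Finite := by
    refine ((List.finite_length_le (Fin (n + 1) × Fin k) n).image
      (List.map fun y => (toLex ((y.1 : ℕ), y.2) : Part k))).subset ?_
    rintro l ⟨hl, hs⟩
    have hv : ∀ x ∈ l, Part.val x < n + 1 := fun x hx =>
      Nat.lt_succ_of_le ((List.le_sum_of_mem (List.mem_map_of_mem hx)).trans hs)
    refine ⟨l.pmap (fun x h => (⟨Part.val x, h⟩, (ofLex x).2)) hv, by simpa using hl, ?_⟩
    rw [List.map_pmap]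
    exact (List.pmap_eq_map hv (f := fun x => x)).trans (List.map_id' l)
  have := hS.to_subtype
  have key : ∀ P : ColoredFPartition k n, P.top ∈ S ∧ P.bot ∈ S := by
    intro P
    have h1 := P.size_eq
    have h2 := P.length_eq
    exact ⟨⟨by omega, by omega⟩, ⟨by omega, by omega⟩⟩
  refine Finite.of_injective (β := S × S)
    (fun P => (⟨P.top, (key P).1⟩, ⟨P.bot, (key P).2⟩)) ?_
  intro P Q h
  simp only [Prod.mk.injEq, Subtype.mk.injEq] at h
  ext1
  · exact h.1
  · exact h.2

/-- `q^r = e^{2πirτ}` for rational `r`. -/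
noncomputable def qpow (r : ℚ) (τ : ℂ) : ℂ :=
  Complex.exp (2 * Real.pi * Complex.I * (r : ℂ) * τ)

/-- `θ_{m,a}(τ) = ∑_{n ∈ ℤ} q^{(2mn+a)²/(4m)}`. -/
noncomputable def theta (m : ℕ) (a : ℤ) (τ : ℂ) : ℂ :=
  ∑' n : ℤ, qpow ((2 * (m : ℚ) * (n : ℚ) + (a : ℚ)) ^ 2 / (4 * (m : ℚ))) τ

/-- The series defining `θ_{m,a}(τ)` converges for `τ` in the upper half plane. -/
theorem summable_theta {m : ℕ} (hm : 0 < m) (a : ℤ) {τ : ℂ} (hτ : 0 < τ.im) :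
    Summable fun n : ℤ =>
      qpow ((2 * (m : ℚ) * (n : ℚ) + (a : ℚ)) ^ 2 / (4 * (m : ℚ))) τ := by
  have hm' : (m : ℂ) ≠ 0 := by exact_mod_cast hm.ne'
  have h : Summable (jacobiTheta₂_term · ((a : ℂ) * τ) (2 * (m : ℂ) * τ)) := by
    rw [summable_jacobiTheta₂_term_iff]
    have : (2 * (m : ℂ) * τ).im = 2 * (m : ℝ) * τ.im := by
      simp [Complex.mul_im]
    rw [this]
    positivity
  refine (h.mul_left (qpow ((a : ℚ) ^ 2 / (4 * (m : ℚ))) τ)).congr fun n => ?_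
  simp only [qpow, jacobiTheta₂_term, ← Complex.exp_add]
  congr 1
  push_cast
  field_simp
  ring

end FPartition

/-!
Splitting an array by colors turns a generalized Frobenius partition in `k` colors into `k` pairs
`(S, T)` of finite sets of natural numbers whose charges `|S| - |T|` add up to `0`
(`ofArrays_bijective`). So the generating function is `∑ ∏ chargeSeries q (c j)` over the integer
vectors `c` with coordinate sum `0` (`exists_hasSum_cphi`).

The series `chargeSeries q c` of a single color is `q^(c(c+1)/2) / ∏ (1 - q^n)`
(`chargeSeries_eq`), which is the Jacobi triple product read off coefficientwise. Its proof uses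
Euler's series `setSeries q k` for the sets with `k` elements: the recursion in `k`, from the
translation `S ↦ S + 1`, gives both `chargeSeries q (c + 1) = q^(c+1) * chargeSeries q c` and the
product formula for `setSeries`, and the constant `chargeSeries q 0` is found by letting `c → ∞`.

For `k = 6` the linear parts of the exponents cancel, and `η⁶` times the generating function is
`q^(1/4)` times the theta series of `A₅ = {c ∈ ℤ⁶ : ∑ c = 0}`. Pair the coordinates and let `s`, `t`
and `-s - t` be the sums of the pairs (`latticeSum_eq`): the differences contribute theta functions
`θ_{1,0}` or `θ_{1,1}` according to the parity of the sums, and there remains a sum over `(s, t)` of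
`q^((s² + t² + (s + t)²)/4)`. On each of the four parity classes of `(s, t)` the hexagonal form is
diagonalized by a change of variables, which gives
`θ_{1,1}(6τ) θ_{1,1}(2τ) + θ_{1,0}(6τ) θ_{1,0}(2τ)` if both are even and
`2 θ_{2,1}(3τ) θ_{2,1}(τ)` in each of the other three cases.
-/

namespace FPartition

open Filter Topology

/-! ### Fibrewise summation and finite products of series -/

theorem hasSum_tsum_ite_fiber {α β : Type*} [DecidableEq β] {f : α → ℂ} {a : ℂ} (hf : HasSum f a)
    (g : α → β) : HasSum (fun b => ∑' x, if g x = b then f x else 0) a := by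
  have h := hf.tsum_fiberwise g
  refine h.congr_fun fun b => ?_
  rw [tsum_subtype (g ⁻¹' {b}) f]
  exact tsum_congr fun x => by simp [Set.indicator]

theorem hasSum_add_of_bijective {α β γ : Type*} {f : γ → ℂ} {i : α → γ} {j : β → γ}
    (h : Function.Bijective (Sum.elim i j)) {a b : ℂ} (hi : HasSum (fun x => f (i x)) a)
    (hj : HasSum (fun x => f (j x)) b) : HasSum f (a + b) :=
  (Equiv.ofBijective _ h).hasSum_iff.mp (HasSum.sum hi hj)

theorem summable_norm_ite {α : Type*} {f : α → ℂ} (hf : Summable fun x => ‖f x‖) (p : α → Prop)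
    [DecidablePred p] : Summable fun x => ‖if p x then f x else 0‖ :=
  hf.of_nonneg_of_le (fun _ => norm_nonneg _) fun x => by split_ifs <;> simp

theorem hasSum_pi_fin_prod {X : Type*} : ∀ {n : ℕ} {f : Fin n → X → ℂ}
    (_ : ∀ i, Summable fun x => ‖f i x‖),
    (Summable fun x : Fin n → X => ‖∏ i, f i (x i)‖) ∧
      HasSum (fun x : Fin n → X => ∏ i, f i (x i)) (∏ i, ∑' x, f i x)
  | 0, f, _ => by
    refine ⟨(hasSum_fintype _).summable, ?_⟩
    simp
  | n + 1, f, hf => by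
    obtain ⟨h1, h2⟩ := hasSum_pi_fin_prod (f := fun i => f i.succ) fun i => hf i.succ
    have h3 := (hf 0).mul_norm h1
    constructor
    · rw [← (Fin.consEquiv (fun _ : Fin (n + 1) => X)).summable_iff]
      refine h3.congr fun x => ?_
      simp [Fin.prod_univ_succ, Fin.consEquiv]
    · rw [← (Fin.consEquiv (fun _ : Fin (n + 1) => X)).hasSum_iff, Fin.prod_univ_succ]
      refine ((hf 0).of_norm.hasSum.mul h2 h3.of_norm).congr_fun fun x => ?_
      simp [Fin.prod_univ_succ, Fin.consEquiv]

/-! ### Finite sets of natural numbers by cardinality -/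

/-- The generating function `∑ q^(sum of S)` over the finite sets `S ⊆ ℕ` with `k` elements; it
vanishes for negative `k`. -/
noncomputable def setSeries (q : ℂ) (k : ℤ) : ℂ :=
  ∑' S : Finset ℕ, if (S.card : ℤ) = k then ∏ n ∈ S, q ^ n else 0

theorem summable_norm_prod_pow {q : ℂ} (hq : ‖q‖ < 1) :
    Summable fun S : Finset ℕ => ‖∏ n ∈ S, q ^ n‖ := by
  have h := summable_finsetProd_of_summable_norm (f := fun n : ℕ => ‖q‖ ^ n)
    (by simpa using summable_geometric_of_lt_one (norm_nonneg _) hq)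
  simpa using h

theorem summable_norm_setSeries {q : ℂ} (hq : ‖q‖ < 1) : Summable fun k => ‖setSeries q k‖ :=
  (hasSum_tsum_ite_fiber (summable_norm_prod_pow hq).of_norm.hasSum
    fun S : Finset ℕ => (S.card : ℤ)).summable.norm

theorem setSeries_of_neg (q : ℂ) {k : ℤ} (hk : k < 0) : setSeries q k = 0 := by
  refine (tsum_congr fun S => if_neg ?_).trans tsum_zero
  omega

theorem setSeries_zero (q : ℂ) : setSeries q 0 = 1 := by
  rw [setSeries, tsum_eq_single ∅]
  · simp
  · intro S hS
    simp [hS]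

/-- The translate `S + 1`. -/
def succFinset (S : Finset ℕ) : Finset ℕ := S.map (addRightEmbedding 1)

theorem zero_notMem_succFinset (S : Finset ℕ) : 0 ∉ succFinset S := by
  simp [succFinset]

theorem succFinset_injective : Function.Injective succFinset :=
  Finset.map_injective _

theorem exists_succFinset {S : Finset ℕ} (h : 0 ∉ S) : ∃ T, succFinset T = S := by
  refine ⟨S.image Nat.pred, ?_⟩
  ext n
  simp only [succFinset, Finset.mem_map, Finset.mem_image, addRightEmbedding_apply]
  constructor
  · rintro ⟨_, ⟨m, hm, rfl⟩, rfl⟩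
    obtain _ | m := m
    · exact absurd hm h
    · simpa using hm
  · intro hn
    obtain _ | n := n
    · exact absurd hn h
    · exact ⟨n, ⟨n + 1, hn, rfl⟩, rfl⟩

/-- A finite set of natural numbers is `T + 1` or `{0} ∪ (T + 1)` for a unique `T`. -/
theorem bijective_elim_succFinset : Function.Bijective
    (Sum.elim succFinset fun T => insert 0 (succFinset T) : Finset ℕ ⊕ Finset ℕ → Finset ℕ) := by
  constructor
  · rintro (S | S) (T | T) h
    · exact congrArg _ (succFinset_injective h)
    · change succFinset S = insert 0 (succFinset T) at h
      exact absurd (h ▸ Finset.mem_insert_self 0 _) (zero_notMem_succFinset S)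
    · change insert 0 (succFinset S) = succFinset T at h
      exact absurd (h ▸ Finset.mem_insert_self 0 _) (zero_notMem_succFinset T)
    · have := congrArg (fun U => Finset.erase U 0) h
      simp only [Sum.elim_inr, Finset.erase_insert (zero_notMem_succFinset _)] at this
      exact congrArg _ (succFinset_injective this)
  · intro S
    by_cases h : 0 ∈ S
    · obtain ⟨T, hT⟩ := exists_succFinset (Finset.notMem_erase 0 S)
      exact ⟨.inr T, by simp [hT, Finset.insert_erase h]⟩
    · obtain ⟨T, hT⟩ := exists_succFinset h
      exact ⟨.inl T, hT⟩

theorem card_succFinset (S : Finset ℕ) : (succFinset S).card = S.card :=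
  Finset.card_map _

theorem prod_pow_succFinset (q : ℂ) (S : Finset ℕ) :
    ∏ n ∈ succFinset S, q ^ n = q ^ S.card * ∏ n ∈ S, q ^ n := by
  simp [succFinset, pow_succ', Finset.prod_mul_distrib]

/-- The sets that do not contain `0` give the first term, those that contain `0` the second. -/
theorem setSeries_eq {q : ℂ} (hq : ‖q‖ < 1) (k : ℤ) :
    setSeries q k = q ^ k * setSeries q k + q ^ (k - 1) * setSeries q (k - 1) := by
  have hs := summable_norm_prod_pow hq
  refine HasSum.tsum_eq (hasSum_add_of_bijective bijective_elim_succFinset ?_ ?_)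
  · refine ((summable_norm_ite hs _).of_norm.hasSum.mul_left (q ^ k)).congr_fun fun S => ?_
    simp only [card_succFinset, prod_pow_succFinset, mul_ite, mul_zero]
    split_ifs with h
    · rw [← h, zpow_natCast]
    · rfl
  · refine ((summable_norm_ite hs _).of_norm.hasSum.mul_left (q ^ (k - 1))).congr_fun fun S => ?_
    simp only [Finset.card_insert_of_notMem (zero_notMem_succFinset S), card_succFinset,
      Finset.prod_insert (zero_notMem_succFinset S), prod_pow_succFinset, mul_ite, mul_zero]
    have : ((S.card + 1 : ℕ) : ℤ) = k ↔ (S.card : ℤ) = k - 1 := by omega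
    simp only [this]
    split_ifs with h
    · rw [← h, zpow_natCast]; simp
    · rfl

theorem one_sub_pow_succ_ne_zero {q : ℂ} (hq : ‖q‖ < 1) (n : ℕ) : 1 - q ^ (n + 1) ≠ 0 := by
  intro h
  have : ‖q ^ (n + 1)‖ = 1 := by rw [← sub_eq_zero.mp h]; simp
  rw [norm_pow] at this
  exact (pow_lt_one₀ (norm_nonneg q) hq n.succ_ne_zero).ne this

/-- Euler's identity `setSeries q k = q^(k(k-1)/2) / ((1-q)⋯(1-q^k))`, multiplied by `q^k` to keep
truncated subtraction out of the exponent. -/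
theorem pow_mul_setSeries {q : ℂ} (hq : ‖q‖ < 1) (k : ℕ) :
    q ^ k * setSeries q k =
      q ^ (∑ i ∈ Finset.range k, (i + 1)) / ∏ i ∈ Finset.range k, (1 - q ^ (i + 1)) := by
  induction k with
  | zero => simp [setSeries_zero]
  | succ k ih =>
    have h := setSeries_eq hq (k + 1)
    simp only [add_sub_cancel_right] at h
    have h1 := one_sub_pow_succ_ne_zero hq k
    have h2 : ∏ i ∈ Finset.range k, (1 - q ^ (i + 1)) ≠ 0 :=
      Finset.prod_ne_zero_iff.mpr fun i _ => one_sub_pow_succ_ne_zero hq i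
    rw [zpow_natCast, ih] at h
    norm_cast at h
    have h3 : setSeries q ((k + 1 : ℕ) : ℤ) = q ^ (∑ i ∈ Finset.range k, (i + 1)) /
        (∏ i ∈ Finset.range k, (1 - q ^ (i + 1))) / (1 - q ^ (k + 1)) := by
      rw [eq_div_iff h1]
      linear_combination h
    rw [h3, Finset.sum_range_succ, Finset.prod_range_succ, pow_add q _ (k + 1), div_div,
      ← mul_div_assoc, mul_comm (q ^ (k + 1))]

/-! ### The Jacobi triple product, coefficient by coefficient -/

/-- The weight `q^(|S| + ∑S + ∑T)` of a one-colored array with rows `S` and `T`, which may have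
different lengths. -/
noncomputable def rowWeight (q : ℂ) (x : Finset ℕ × Finset ℕ) : ℂ :=
  (q ^ x.1.card * ∏ n ∈ x.1, q ^ n) * ∏ n ∈ x.2, q ^ n

/-- The charge `|S| - |T|` of a one-colored array with rows `S` and `T`. -/
def charge (x : Finset ℕ × Finset ℕ) : ℤ := x.1.card - x.2.card

/-- The generating function of the one-colored arrays of charge `c`, that is, the coefficient of
`z^c` in `∏ (1 + z q^(n+1)) (1 + z⁻¹ q^n)`. -/
noncomputable def chargeSeries (q : ℂ) (c : ℤ) : ℂ :=
  ∑' x, if charge x = c then rowWeight q x else 0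

theorem summable_norm_pow_card_mul {q : ℂ} (hq : ‖q‖ < 1) :
    Summable fun S : Finset ℕ => ‖q ^ S.card * ∏ n ∈ S, q ^ n‖ :=
  (summable_norm_prod_pow hq).of_nonneg_of_le (fun _ => norm_nonneg _) fun S => by
    rw [norm_mul, norm_pow]
    exact mul_le_of_le_one_left (norm_nonneg _) (pow_le_one₀ (norm_nonneg _) hq.le)

theorem summable_norm_rowWeight {q : ℂ} (hq : ‖q‖ < 1) : Summable fun x => ‖rowWeight q x‖ :=
  Summable.mul_norm (f := fun S : Finset ℕ => q ^ S.card * ∏ n ∈ S, q ^ n)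
    (g := fun S : Finset ℕ => ∏ n ∈ S, q ^ n)
    (summable_norm_pow_card_mul hq) (summable_norm_prod_pow hq)

theorem tsum_ite_card_eq {q : ℂ} (k : ℤ) :
    (∑' S : Finset ℕ, if (S.card : ℤ) = k then q ^ S.card * ∏ n ∈ S, q ^ n else 0) =
      q ^ k * setSeries q k := by
  rw [setSeries, ← tsum_mul_left]
  refine tsum_congr fun S => ?_
  split_ifs with h
  · rw [← h, zpow_natCast]
  · simp

theorem hasSum_chargeSeries {q : ℂ} (hq : ‖q‖ < 1) (c : ℤ) :
    HasSum (fun k : ℤ => q ^ k * setSeries q k * setSeries q (k - c)) (chargeSeries q c) := by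
  have h := hasSum_tsum_ite_fiber
    (summable_norm_ite (summable_norm_rowWeight hq) fun x => charge x = c).of_norm.hasSum
    fun x => (x.1.card : ℤ)
  refine h.congr_fun fun k => ?_
  rw [← tsum_ite_card_eq, setSeries, tsum_mul_tsum_of_summable_norm
    (summable_norm_ite (summable_norm_pow_card_mul hq) _)
    (summable_norm_ite (summable_norm_prod_pow hq) _)]
  refine tsum_congr fun x => ?_
  have hc : charge x = x.1.card - x.2.card := rfl
  by_cases h1 : (x.1.card : ℤ) = k
  · by_cases h2 : (x.2.card : ℤ) = k - c
    · rw [if_pos h1, if_pos h1, if_pos h2, if_pos (by omega), rowWeight]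
    · have h3 : charge x ≠ c := fun h => h2 (by omega)
      rw [if_pos h1, if_neg h2, if_neg h3, if_pos h1, mul_zero]
  · rw [if_neg h1, if_neg h1, zero_mul]

theorem chargeSeries_add_one {q : ℂ} (hq : ‖q‖ < 1) (h0 : q ≠ 0) (c : ℤ) :
    chargeSeries q (c + 1) = q ^ (c + 1) * chargeSeries q c := by
  have hsum (d : ℤ) : Summable fun k : ℤ => q ^ (2 * k) * setSeries q k * setSeries q (k - d) := by
    refine (hasSum_chargeSeries hq d).summable.norm.of_norm_bounded fun k => ?_
    rcases lt_or_ge k 0 with hk | hk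
    · simp [setSeries_of_neg q hk]
    · rw [two_mul, zpow_add₀ h0, mul_assoc, mul_assoc, mul_assoc, norm_mul]
      refine mul_le_of_le_one_left (norm_nonneg _) ?_
      lift k to ℕ using hk
      rw [zpow_natCast, norm_pow]
      exact pow_le_one₀ (norm_nonneg _) hq.le
  have hA := (hsum (c + 1)).hasSum
  have hB := (hsum c).hasSum
  have hz (k : ℤ) : q ^ (2 * k) = q ^ k * q ^ k := by rw [two_mul, zpow_add₀ h0]
  -- Both sides become the same combination of two series if `setSeries_eq` is applied to the first
  -- factor for charge `c + 1`, and to the second factor for charge `c`.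
  have h1 : HasSum (fun k : ℤ => q ^ k * setSeries q k * setSeries q (k - (c + 1)))
      ((∑' k : ℤ, q ^ (2 * k) * setSeries q k * setSeries q (k - (c + 1))) +
        q * ∑' k : ℤ, q ^ (2 * k) * setSeries q k * setSeries q (k - c)) := by
    have hB' := (Equiv.subRight (1 : ℤ)).hasSum_iff.mpr (hB.mul_left q)
    refine (hA.add hB').congr_fun fun k => ?_
    have hp : q ^ k * q ^ (k - 1) = q * q ^ (2 * (k - 1)) := by
      rw [← zpow_add₀ h0, ← zpow_one_add₀ h0]
      congr 1
      ring
    simp only [Function.comp_apply, Equiv.subRight_apply, hz k, sub_sub, add_comm 1 c]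
    linear_combination (q ^ k * setSeries q (k - (c + 1))) * setSeries_eq hq k +
      setSeries q (k - 1) * setSeries q (k - (c + 1)) * hp
  have h2 : HasSum (fun k : ℤ => q ^ (c + 1) * (q ^ k * setSeries q k * setSeries q (k - c)))
      ((∑' k : ℤ, q ^ (2 * k) * setSeries q k * setSeries q (k - (c + 1))) +
        q * ∑' k : ℤ, q ^ (2 * k) * setSeries q k * setSeries q (k - c)) := by
    refine (hA.add (hB.mul_left q)).congr_fun fun k => ?_
    have hp1 : q ^ (c + 1) * q ^ k * q ^ (k - c) = q * q ^ (2 * k) := by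
      rw [← zpow_add₀ h0, ← zpow_add₀ h0, ← zpow_one_add₀ h0]
      congr 1
      ring
    have hp2 : q ^ (c + 1) * q ^ k * q ^ (k - c - 1) = q ^ (2 * k) := by
      rw [← zpow_add₀ h0, ← zpow_add₀ h0]
      congr 1
      ring
    have h := setSeries_eq hq (k - c)
    rw [← sub_sub]
    linear_combination (q ^ (c + 1) * q ^ k * setSeries q k) * h +
      setSeries q k * setSeries q (k - c) * hp1 + setSeries q k * setSeries q (k - c - 1) * hp2
  exact ((hasSum_chargeSeries hq _).unique h1).trans
    (((hasSum_chargeSeries hq _).mul_left _).unique h2).symm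

theorem chargeSeries_natCast {q : ℂ} (hq : ‖q‖ < 1) (h0 : q ≠ 0) (c : ℕ) :
    chargeSeries q c = q ^ (∑ i ∈ Finset.range c, (i + 1)) * chargeSeries q 0 := by
  induction c with
  | zero => simp
  | succ c ih =>
    have h := chargeSeries_add_one hq h0 c
    rw [ih] at h
    rw [Nat.cast_succ, h, Finset.sum_range_succ, pow_add]
    norm_cast
    ring

theorem tprod_one_sub_pow_ne_zero {q : ℂ} (hq : ‖q‖ < 1) : ∏' n : ℕ, (1 - q ^ (n + 1)) ≠ 0 := by
  have hs := (summable_nat_add_iff 1).mpr (summable_geometric_of_lt_one (norm_nonneg q) hq)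
  simp_rw [sub_eq_add_neg]
  refine tprod_one_add_ne_zero_of_summable (f := fun n : ℕ => -(q ^ (n + 1))) (fun n => ?_) ?_
  · rw [← sub_eq_add_neg]
    exact one_sub_pow_succ_ne_zero hq n
  · simpa using hs

/-- The arrays of charge `0` are counted by `1 / ∏ (1 - q^n)`. In the series for charge `c`,
divided by `q^(c(c+1)/2)`, only the arrays with empty second row survive as `c → ∞`. -/
theorem chargeSeries_zero {q : ℂ} (hq : ‖q‖ < 1) (h0 : q ≠ 0) :
    chargeSeries q 0 = (∏' n : ℕ, (1 - q ^ (n + 1)))⁻¹ := by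
  have hP : Tendsto (fun c : ℕ => (∏ i ∈ Finset.range c, (1 - q ^ (i + 1)))⁻¹) atTop
      (𝓝 (∏' n : ℕ, (1 - q ^ (n + 1)))⁻¹) :=
    (ModularForm.multipliable_one_sub_pow hq).hasProd.tendsto_prod_nat.inv₀
      (tprod_one_sub_pow_ne_zero hq)
  obtain ⟨C, hC⟩ := hP.norm.bddAbove_range
  have hC' (c : ℕ) : ‖(∏ i ∈ Finset.range c, (1 - q ^ (i + 1)))⁻¹‖ ≤ C := hC ⟨c, rfl⟩
  -- The summand belonging to a second row with `l` elements.
  let u (c l : ℕ) : ℂ := q ^ (∑ i ∈ Finset.range l, (c + i + 1)) *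
    (∏ i ∈ Finset.range (c + l), (1 - q ^ (i + 1)))⁻¹ * setSeries q l
  have hu (c : ℕ) : HasSum (u c) (chargeSeries q 0) := by
    have h1 := (Equiv.addRight (c : ℤ)).hasSum_iff.mpr (hasSum_chargeSeries hq c)
    have h2 := (Nat.cast_injective (R := ℤ)).hasSum_iff (fun k hk => ?_) |>.mpr h1
    · have hq0 : q ^ (∑ i ∈ Finset.range c, (i + 1)) ≠ 0 := pow_ne_zero _ h0
      rw [chargeSeries_natCast hq h0] at h2
      rw [← inv_mul_cancel_left₀ hq0 (chargeSeries q 0)]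
      refine (h2.mul_left _).congr_fun fun l => ?_
      have h3 := pow_mul_setSeries hq (c + l)
      simp only [Function.comp_apply, Equiv.coe_addRight, add_sub_cancel_right]
      rw [add_comm (l : ℤ) c, ← Nat.cast_add, zpow_natCast, h3, Finset.sum_range_add, pow_add]
      field_simp
      simp only [u, div_eq_mul_inv]
      ring
    · have : k < 0 := by
        by_contra h
        exact hk ⟨k.toNat, by simp; omega⟩
      simp [setSeries_of_neg q this]
  have hlim : Tendsto (fun c => ∑' l, u c l) atTop
      (𝓝 (∑' l : ℕ, if l = 0 then (∏' n : ℕ, (1 - q ^ (n + 1)))⁻¹ else 0)) := by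
    refine tendsto_tsum_of_dominated_convergence (bound := fun l : ℕ => C * ‖setSeries q l‖)
      (((summable_norm_setSeries hq).comp_injective Nat.cast_injective).mul_left C) ?_ ?_
    · intro l
      obtain _ | l := l
      · simpa [u, setSeries_zero] using hP
      · have hpow : Tendsto (fun c : ℕ => q ^ (∑ i ∈ Finset.range (l + 1), (c + i + 1))) atTop
            (𝓝 0) := by
          refine (tendsto_pow_atTop_nhds_zero_of_norm_lt_one hq).comp ?_
          refine tendsto_atTop_mono (fun c => ?_) tendsto_id
          rw [Finset.sum_range_succ]
          simp; omega
        have := (hpow.mul (hP.comp (tendsto_add_atTop_nat (l + 1)))).mul_const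
          (setSeries q (l + 1 : ℕ))
        simpa [u] using this
    · refine Eventually.of_forall fun c l => ?_
      simp only [u, norm_mul]
      refine mul_le_mul_of_nonneg_right ?_ (norm_nonneg _)
      refine (mul_le_of_le_one_left (norm_nonneg _) ?_).trans (hC' _)
      rw [norm_pow]
      exact pow_le_one₀ (norm_nonneg _) hq.le
  rw [tsum_ite_eq] at hlim
  simp only [fun c => (hu c).tsum_eq] at hlim
  exact tendsto_nhds_unique tendsto_const_nhds hlim

/-- The coefficient form of the Jacobi triple product. -/
theorem chargeSeries_eq {q : ℂ} (hq : ‖q‖ < 1) (h0 : q ≠ 0) (c : ℤ) :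
    chargeSeries q c = q ^ (c * (c + 1) / 2) * (∏' n : ℕ, (1 - q ^ (n + 1)))⁻¹ := by
  have hstep (c : ℤ) : (c + 1) * (c + 1 + 1) / 2 = c * (c + 1) / 2 + (c + 1) := by
    rw [show (c + 1) * (c + 1 + 1) = c * (c + 1) + (c + 1) * 2 by ring,
      Int.add_mul_ediv_right _ _ two_ne_zero]
  induction c using Int.induction_on with
  | zero => simpa using chargeSeries_zero hq h0
  | succ c ih =>
    rw [chargeSeries_add_one hq h0, ih, hstep, zpow_add₀ h0 _ ((c : ℤ) + 1), ← mul_assoc,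
      mul_comm (q ^ ((c : ℤ) + 1))]
  | pred c ih =>
    have h := chargeSeries_add_one hq h0 (-c - 1)
    have h' := hstep (-c - 1)
    rw [sub_add_cancel] at h h'
    rw [ih, h', zpow_add₀ h0] at h
    refine mul_left_cancel₀ (zpow_ne_zero (-(c : ℤ)) h0) (h.symm.trans ?_)
    rw [sub_add_cancel]
    ring

/-! ### The theta function of the lattice `A₅` -/

theorem qpow_add (r s : ℚ) (τ : ℂ) : qpow (r + s) τ = qpow r τ * qpow s τ := by
  simp only [qpow, ← Complex.exp_add]
  congr 1
  push_cast
  ring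

theorem qpow_zero (τ : ℂ) : qpow 0 τ = 1 := by simp [qpow]

theorem qpow_natCast_mul_right (r : ℚ) (n : ℕ) (τ : ℂ) : qpow r (n * τ) = qpow (n * r) τ := by
  simp only [qpow]
  congr 1
  push_cast
  ring

theorem qpow_one_zpow (n : ℤ) (τ : ℂ) : qpow 1 τ ^ n = qpow n τ := by
  simp only [qpow, ← Complex.exp_int_mul]
  congr 1
  push_cast
  ring

theorem prod_qpow {ι : Type*} (s : Finset ι) (r : ι → ℚ) (τ : ℂ) :
    ∏ i ∈ s, qpow (r i) τ = qpow (∑ i ∈ s, r i) τ := by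
  classical
  induction s using Finset.induction_on with
  | empty => simp [qpow_zero]
  | insert i s hi ih => rw [Finset.prod_insert hi, Finset.sum_insert hi, ih, qpow_add]

theorem norm_qpow_one_lt {τ : ℂ} (hτ : 0 < τ.im) : ‖qpow 1 τ‖ < 1 := by
  simpa [qpow] using UpperHalfPlane.norm_exp_two_pi_I_lt_one ⟨τ, hτ⟩

theorem hasSum_theta {m : ℕ} (hm : 0 < m) (a : ℤ) {τ : ℂ} (hτ : 0 < τ.im) :
    HasSum (fun n : ℤ => qpow ((2 * (m : ℚ) * (n : ℚ) + (a : ℚ)) ^ 2 / (4 * (m : ℚ))) τ)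
      (theta m a τ) :=
  (summable_theta hm a hτ).hasSum

theorem theta_add_mul (m : ℕ) (a b : ℤ) (τ : ℂ) : theta m (a + 2 * m * b) τ = theta m a τ := by
  rw [theta, theta, ← (Equiv.addRight b).tsum_eq fun n : ℤ =>
    qpow ((2 * (m : ℚ) * (n : ℚ) + (a : ℚ)) ^ 2 / (4 * (m : ℚ))) τ]
  refine tsum_congr fun n => ?_
  congr 2
  simp only [Equiv.coe_addRight]
  push_cast
  ring

theorem theta_one_two_mul (a : ℤ) (τ : ℂ) : theta 1 (2 * a) τ = theta 1 0 τ := by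
  rw [← theta_add_mul 1 0 a]
  congr 1
  push_cast
  ring

theorem theta_one_two_mul_add_one (a : ℤ) (τ : ℂ) : theta 1 (2 * a + 1) τ = theta 1 1 τ := by
  rw [← theta_add_mul 1 1 a]
  congr 1
  push_cast
  ring

theorem hasSum_mul_prod {α β : Type*} {f : α → ℂ} {g : β → ℂ} {a b : ℂ} (hf : HasSum f a)
    (hg : HasSum g b) : HasSum (fun x : α × β => f x.1 * g x.2) (a * b) :=
  hf.mul hg (summable_mul_of_summable_norm hf.summable.norm hg.summable.norm)

/-- Summation over the vectors of `ℤ²` with given coordinate sum `s`. -/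
theorem hasSum_coordinate_sum {τ : ℂ} (hτ : 0 < τ.im) (s : ℤ) :
    HasSum (fun x : ℤ => qpow ((x : ℚ) ^ 2 / 2) τ * qpow (((s - x : ℤ) : ℚ) ^ 2 / 2) τ)
      (qpow ((s : ℚ) ^ 2 / 4) τ * theta 1 (-s) τ) := by
  refine ((hasSum_theta one_pos (-s) hτ).mul_left _).congr_fun fun x => ?_
  rw [← qpow_add, ← qpow_add]
  congr 1
  push_cast
  ring

/-- The quadratic form `(s² + t² + (s + t)²) / 4`, half the norm form `s² + st + t²` of the hexagonal
lattice. -/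
def hexForm (s t : ℤ) : ℚ := ((s : ℚ) ^ 2 + (t : ℚ) ^ 2 + ((s : ℚ) + t) ^ 2) / 4

theorem hexForm_comm (s t : ℤ) : hexForm s t = hexForm t s := by
  simp only [hexForm]
  ring

theorem hasSum_hexForm_even_even {τ : ℂ} (hτ : 0 < τ.im) :
    HasSum (fun p : ℤ × ℤ => qpow (hexForm (2 * p.1) (2 * p.2)) τ)
      (theta 1 1 (6 * τ) * theta 1 1 (2 * τ) + theta 1 0 (6 * τ) * theta 1 0 (2 * τ)) := by
  have h6 : 0 < (6 * τ).im := by simpa using hτ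
  have h2 : 0 < (2 * τ).im := by simpa using hτ
  have e6 (r : ℚ) : qpow r (6 * τ) = qpow (6 * r) τ := qpow_natCast_mul_right r 6 τ
  have e2 (r : ℚ) : qpow r (2 * τ) = qpow (2 * r) τ := qpow_natCast_mul_right r 2 τ
  refine hasSum_add_of_bijective (i := fun p : ℤ × ℤ => (p.1 + p.2 + 1, p.1 - p.2))
    (j := fun p : ℤ × ℤ => (p.1 + p.2, p.1 - p.2)) ?_ ?_ ?_
  · constructor
    · rintro (⟨a, b⟩ | ⟨a, b⟩) (⟨c, d⟩ | ⟨c, d⟩) h <;>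
        simp only [Sum.elim_inl, Sum.elim_inr, Prod.mk.injEq, Sum.inl.injEq, Sum.inr.injEq,
          reduceCtorEq] at h ⊢ <;> omega
    · rintro ⟨x, y⟩
      rcases Int.even_or_odd' (x + y) with ⟨k, hk | hk⟩
      · exact ⟨.inr (k, x - k), Prod.ext (by simp) (by simp; omega)⟩
      · exact ⟨.inl (k, x - k - 1), Prod.ext (by simp; omega) (by simp; omega)⟩
  · refine (hasSum_mul_prod (hasSum_theta one_pos 1 h6)
      (hasSum_theta one_pos 1 h2)).congr_fun fun p => ?_
    rw [e6, e2, ← qpow_add, hexForm]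
    congr 1
    push_cast
    ring
  · refine (hasSum_mul_prod (hasSum_theta one_pos 0 h6)
      (hasSum_theta one_pos 0 h2)).congr_fun fun p => ?_
    rw [e6, e2, ← qpow_add, hexForm]
    congr 1
    push_cast
    ring

theorem hasSum_theta_two_mul {τ : ℂ} (hτ : 0 < τ.im) :
    HasSum (fun p : ℤ × ℤ => qpow ((3 * (4 * (p.1 : ℚ) + 1) ^ 2 + (4 * (p.2 : ℚ) + 1) ^ 2) / 8) τ)
      (theta 2 1 (3 * τ) * theta 2 1 τ) := by
  have h3 : 0 < (3 * τ).im := by simpa using hτ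
  have e3 (r : ℚ) : qpow r (3 * τ) = qpow (3 * r) τ := qpow_natCast_mul_right r 3 τ
  refine (hasSum_mul_prod (hasSum_theta two_pos 1 h3)
    (hasSum_theta two_pos 1 hτ)).congr_fun fun p => ?_
  rw [e3, ← qpow_add]
  congr 1
  push_cast
  ring

theorem hasSum_hexForm_odd_odd {τ : ℂ} (hτ : 0 < τ.im) :
    HasSum (fun p : ℤ × ℤ => qpow (hexForm (2 * p.1 + 1) (2 * p.2 + 1)) τ)
      (2 * (theta 2 1 (3 * τ) * theta 2 1 τ)) := by
  rw [two_mul]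
  -- The substitution is `s = ±(4m + 1)`, `s + 2t = ∓(4n + 1)`, for which
  -- `4 (s² + st + t²) = 3s² + (s + 2t)²`.
  refine hasSum_add_of_bijective (i := fun p : ℤ × ℤ => (2 * p.1, -(p.1 + p.2 + 1)))
    (j := fun p : ℤ × ℤ => (-2 * p.1 - 1, p.1 + p.2)) ?_ ?_ ?_
  · constructor
    · rintro (⟨a, b⟩ | ⟨a, b⟩) (⟨c, d⟩ | ⟨c, d⟩) h <;>
        simp only [Sum.elim_inl, Sum.elim_inr, Prod.mk.injEq, Sum.inl.injEq, Sum.inr.injEq,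
          reduceCtorEq] at h ⊢ <;> omega
    · rintro ⟨x, y⟩
      rcases Int.even_or_odd' x with ⟨k, hk | hk⟩
      · exact ⟨.inl (k, -y - k - 1), Prod.ext (by simp; omega) (by simp; omega)⟩
      · exact ⟨.inr (-k - 1, y + k + 1), Prod.ext (by simp; omega) (by simp)⟩
  all_goals
    refine (hasSum_theta_two_mul hτ).congr_fun fun p => ?_
    rw [hexForm]
    congr 1
    push_cast
    ring

theorem hasSum_hexForm_odd_even {τ : ℂ} (hτ : 0 < τ.im) :
    HasSum (fun p : ℤ × ℤ => qpow (hexForm (2 * p.1 + 1) (2 * p.2)) τ)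
      (2 * (theta 2 1 (3 * τ) * theta 2 1 τ)) := by
  rw [two_mul]
  -- The substitution is `s = ±(4m + 1)`, `s + 2t = ±(4n + 1)`.
  refine hasSum_add_of_bijective (i := fun p : ℤ × ℤ => (2 * p.1, p.2 - p.1))
    (j := fun p : ℤ × ℤ => (-2 * p.1 - 1, p.1 - p.2)) ?_ ?_ ?_
  · constructor
    · rintro (⟨a, b⟩ | ⟨a, b⟩) (⟨c, d⟩ | ⟨c, d⟩) h <;>
        simp only [Sum.elim_inl, Sum.elim_inr, Prod.mk.injEq, Sum.inl.injEq, Sum.inr.injEq,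
          reduceCtorEq] at h ⊢ <;> omega
    · rintro ⟨x, y⟩
      rcases Int.even_or_odd' x with ⟨k, hk | hk⟩
      · exact ⟨.inl (k, y + k), Prod.ext (by simp; omega) (by simp)⟩
      · exact ⟨.inr (-k - 1, -k - 1 - y), Prod.ext (by simp; omega) (by simp)⟩
  all_goals
    refine (hasSum_theta_two_mul hτ).congr_fun fun p => ?_
    rw [hexForm]
    congr 1
    push_cast
    ring

/-- `ℤ²` is the disjoint union of the four classes modulo `2`. -/
theorem bijective_elim_parity : Function.Bijective (Sum.elim
    (Sum.elim (fun p : ℤ × ℤ => (2 * p.1, 2 * p.2)) fun p : ℤ × ℤ => (2 * p.1 + 1, 2 * p.2 + 1))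
    (Sum.elim (fun p : ℤ × ℤ => (2 * p.1 + 1, 2 * p.2))
      fun p : ℤ × ℤ => (2 * p.1, 2 * p.2 + 1))) := by
  constructor
  · rintro ((⟨a, b⟩ | ⟨a, b⟩) | (⟨a, b⟩ | ⟨a, b⟩)) ((⟨c, d⟩ | ⟨c, d⟩) | (⟨c, d⟩ | ⟨c, d⟩)) h <;>
      simp only [Sum.elim_inl, Sum.elim_inr, Prod.mk.injEq, Sum.inl.injEq, Sum.inr.injEq,
        reduceCtorEq] at h ⊢ <;> omega
  · rintro ⟨x, y⟩
    rcases Int.even_or_odd' x with ⟨k, rfl | rfl⟩ <;>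
      rcases Int.even_or_odd' y with ⟨l, rfl | rfl⟩
    · exact ⟨.inl (.inl (k, l)), rfl⟩
    · exact ⟨.inr (.inr (k, l)), rfl⟩
    · exact ⟨.inr (.inl (k, l)), rfl⟩
    · exact ⟨.inl (.inr (k, l)), rfl⟩

theorem hasSum_hexForm_mul_theta {τ : ℂ} (hτ : 0 < τ.im) :
    HasSum (fun p : ℤ × ℤ => qpow (hexForm p.1 p.2) τ *
        (theta 1 (-p.1) τ * (theta 1 (-p.2) τ * theta 1 (p.1 + p.2) τ)))
      (6 * theta 1 1 τ ^ 2 * theta 1 0 τ * theta 2 1 (3 * τ) * theta 2 1 τ +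
        theta 1 0 τ ^ 3 *
          (theta 1 1 (6 * τ) * theta 1 1 (2 * τ) + theta 1 0 (6 * τ) * theta 1 0 (2 * τ))) := by
  have he (a b : ℤ) (h : a = 2 * b) : theta 1 a τ = theta 1 0 τ := h ▸ theta_one_two_mul b τ
  have ho (a b : ℤ) (h : a = 2 * b + 1) : theta 1 a τ = theta 1 1 τ :=
    h ▸ theta_one_two_mul_add_one b τ
  have hee := hasSum_hexForm_even_even hτ
  have hoo := hasSum_hexForm_odd_odd hτ
  have hoe := hasSum_hexForm_odd_even hτ
  have heo := (Equiv.prodComm ℤ ℤ).hasSum_iff.mpr hoe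
  have key := (Equiv.ofBijective _ bijective_elim_parity).hasSum_iff (f := fun p : ℤ × ℤ =>
    qpow (hexForm p.1 p.2) τ * (theta 1 (-p.1) τ * (theta 1 (-p.2) τ * theta 1 (p.1 + p.2) τ)))
    |>.mp (((hee.mul_right (theta 1 0 τ ^ 3)).congr_fun fun p => ?_).sum
      ((hoo.mul_right (theta 1 1 τ ^ 2 * theta 1 0 τ)).congr_fun fun p => ?_) |>.sum
      (((hoe.mul_right (theta 1 1 τ ^ 2 * theta 1 0 τ)).congr_fun fun p => ?_).sum
      ((heo.mul_right (theta 1 1 τ ^ 2 * theta 1 0 τ)).congr_fun fun p => ?_)))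
  · convert key using 1
    ring
  · change qpow (hexForm (2 * p.1) (2 * p.2)) τ * (theta 1 (-(2 * p.1)) τ *
      (theta 1 (-(2 * p.2)) τ * theta 1 (2 * p.1 + 2 * p.2) τ)) = _
    rw [he (-(2 * p.1)) (-p.1) (by ring), he (-(2 * p.2)) (-p.2) (by ring),
      he (2 * p.1 + 2 * p.2) (p.1 + p.2) (by ring)]
    ring
  · change qpow (hexForm (2 * p.1 + 1) (2 * p.2 + 1)) τ * (theta 1 (-(2 * p.1 + 1)) τ *
      (theta 1 (-(2 * p.2 + 1)) τ * theta 1 (2 * p.1 + 1 + (2 * p.2 + 1)) τ)) = _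
    rw [ho (-(2 * p.1 + 1)) (-p.1 - 1) (by ring), ho (-(2 * p.2 + 1)) (-p.2 - 1) (by ring),
      he (2 * p.1 + 1 + (2 * p.2 + 1)) (p.1 + p.2 + 1) (by ring)]
    ring
  · change qpow (hexForm (2 * p.1 + 1) (2 * p.2)) τ * (theta 1 (-(2 * p.1 + 1)) τ *
      (theta 1 (-(2 * p.2)) τ * theta 1 (2 * p.1 + 1 + 2 * p.2) τ)) = _
    rw [ho (-(2 * p.1 + 1)) (-p.1 - 1) (by ring), he (-(2 * p.2)) (-p.2) (by ring),
      ho (2 * p.1 + 1 + 2 * p.2) (p.1 + p.2) (by ring)]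
    ring
  · change qpow (hexForm (2 * p.1) (2 * p.2 + 1)) τ * (theta 1 (-(2 * p.1)) τ *
      (theta 1 (-(2 * p.2 + 1)) τ * theta 1 (2 * p.1 + (2 * p.2 + 1)) τ)) =
      qpow (hexForm (2 * p.2 + 1) (2 * p.1)) τ * _
    rw [he (-(2 * p.1)) (-p.1) (by ring), ho (-(2 * p.2 + 1)) (-p.2 - 1) (by ring),
      ho (2 * p.1 + (2 * p.2 + 1)) (p.1 + p.2) (by ring), hexForm_comm]
    ring

/-- The theta series of `A₅ = {c ∈ ℤ⁶ : ∑ c = 0}`: the coordinates are paired, `s`, `t` and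
`-s - t` being the sums of the three pairs. -/
theorem latticeSum_eq {τ : ℂ} (hτ : 0 < τ.im) {a : ℂ}
    (h : HasSum (fun c : Fin 6 → ℤ =>
      if ∑ i, c i = 0 then ∏ i, qpow ((c i : ℚ) ^ 2 / 2) τ else 0) a) :
    a = 6 * theta 1 1 τ ^ 2 * theta 1 0 τ * theta 2 1 (3 * τ) * theta 2 1 τ +
        theta 1 0 τ ^ 3 *
          (theta 1 1 (6 * τ) * theta 1 1 (2 * τ) + theta 1 0 (6 * τ) * theta 1 0 (2 * τ)) := by
  let i : (ℤ × ℤ) × (ℤ × ℤ × ℤ) → Fin 6 → ℤ := fun p =>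
    ![p.2.1, p.1.1 - p.2.1, p.2.2.1, p.1.2 - p.2.2.1, p.2.2.2, -(p.1.1 + p.1.2) - p.2.2.2]
  have hi : Function.Injective i := by
    rintro ⟨⟨s, t⟩, x, y, z⟩ ⟨⟨s', t'⟩, x', y', z'⟩ h
    have h0 := congrFun h 0
    have h1 := congrFun h 1
    have h2 := congrFun h 2
    have h3 := congrFun h 3
    have h4 := congrFun h 4
    simp [i] at h0 h1 h2 h3 h4
    simp only [Prod.mk.injEq]
    omega
  have h' := (hi.hasSum_iff fun c hc => ?_).mpr h
  · refine HasSum.unique (HasSum.prod_fiberwise h' fun p => ?_) (hasSum_hexForm_mul_theta hτ)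
    have h3 := hasSum_mul_prod (hasSum_coordinate_sum hτ p.1)
      (hasSum_mul_prod (hasSum_coordinate_sum hτ p.2) (hasSum_coordinate_sum hτ (-(p.1 + p.2))))
    have e : qpow (hexForm p.1 p.2) τ *
        (theta 1 (-p.1) τ * (theta 1 (-p.2) τ * theta 1 (p.1 + p.2) τ)) =
        qpow ((p.1 : ℚ) ^ 2 / 4) τ * theta 1 (-p.1) τ * (qpow ((p.2 : ℚ) ^ 2 / 4) τ *
          theta 1 (-p.2) τ * (qpow (((-(p.1 + p.2) : ℤ) : ℚ) ^ 2 / 4) τ *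
          theta 1 (- -(p.1 + p.2)) τ)) := by
      rw [neg_neg, show hexForm p.1 p.2 = (p.1 : ℚ) ^ 2 / 4 + ((p.2 : ℚ) ^ 2 / 4 +
        ((-(p.1 + p.2) : ℤ) : ℚ) ^ 2 / 4) by rw [hexForm]; push_cast; ring, qpow_add, qpow_add]
      ring
    rw [e]
    refine h3.congr_fun fun x => ?_
    have hs : ∑ k, i (p, x) k = 0 := by
      simp [i, Fin.sum_univ_succ]
      ring
    simp only [Function.comp_apply, hs, if_true]
    simp [i, Fin.prod_univ_succ, mul_assoc]
  · refine if_neg fun hsum => hc ⟨((c 0 + c 1, c 2 + c 3), c 0, c 2, c 4), ?_⟩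
    simp only [Fin.sum_univ_succ, Fin.sum_univ_zero] at hsum
    ext k
    fin_cases k <;> simp [i]
    simp at hsum
    omega

/-! ### Colored partitions as families of one-colored arrays -/

/-- The strictly decreasing row of colored integers whose entries of color `j` form the set
`S j`. -/
def row {k : ℕ} (S : Fin k → Finset ℕ) : List (Part k) :=
  ((Finset.univ.sigma S).map
    ⟨fun p => toLex (p.2, p.1), fun p p' h => by
      have h' := Prod.ext_iff.mp (toLex.injective h)
      exact Sigma.ext h'.2 (heq_of_eq h'.1)⟩).sort (· ≥ ·)

theorem mem_row {k : ℕ} (S : Fin k → Finset ℕ) (m : ℕ) (j : Fin k) :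
    toLex (m, j) ∈ row S ↔ m ∈ S j := by
  simp only [row, Finset.mem_sort, Finset.mem_map, Finset.mem_sigma, Finset.mem_univ,
    true_and]
  constructor
  · rintro ⟨⟨j', m'⟩, h, he⟩
    obtain ⟨rfl, rfl⟩ := Prod.ext_iff.mp (toLex.injective he)
    exact h
  · exact fun h => ⟨⟨j, m⟩, h, rfl⟩

theorem pairwise_row {k : ℕ} (S : Fin k → Finset ℕ) : (row S).Pairwise (fun x y => x > y) :=
  (Finset.sortedGT_sort _).pairwise

theorem row_injective {k : ℕ} : Function.Injective (row (k := k)) := fun S T h => by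
  funext j
  ext m
  rw [← mem_row, h, mem_row]

theorem exists_row_eq {k : ℕ} {l : List (Part k)} (hl : l.Pairwise (fun x y => x > y)) :
    ∃ S, row S = l := by
  refine ⟨fun j => (l.toFinset.filter fun x => (ofLex x).2 = j).image Part.val, ?_⟩
  have hperm :
      (row fun j => (l.toFinset.filter fun x => (ofLex x).2 = j).image Part.val).Perm l := by
    refine (List.perm_ext_iff_of_nodup (Finset.sort_nodup _ _) (hl.imp fun h => h.ne')).mpr ?_
    intro x
    obtain ⟨m, j⟩ := x
    refine (mem_row _ m j).trans ?_
    simp only [Finset.mem_image, Finset.mem_filter, List.mem_toFinset]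
    constructor
    · rintro ⟨y, ⟨hy, rfl⟩, rfl⟩
      exact hy
    · exact fun h => ⟨_, ⟨h, rfl⟩, rfl⟩
  exact hperm.eq_of_pairwise (fun a b _ _ h h' => absurd h (lt_asymm h')) (pairwise_row _) hl

theorem length_row {k : ℕ} (S : Fin k → Finset ℕ) : (row S).length = ∑ j, (S j).card := by
  simp [row]

theorem sum_val_row {k : ℕ} (S : Fin k → Finset ℕ) :
    ((row S).map Part.val).sum = ∑ j, ∑ n ∈ S j, n := by
  rw [row, ← Multiset.sum_coe, ← Multiset.map_coe, Finset.sort_eq]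
  change ∑ x ∈ Finset.map _ _, Part.val x = _
  rw [Finset.sum_map, Finset.sum_sigma]
  rfl

theorem sigma_coloredFPartition_ext {k : ℕ} {P Q : Σ n, ColoredFPartition k n}
    (h1 : P.2.top = Q.2.top) (h2 : P.2.bot = Q.2.bot) : P = Q := by
  obtain ⟨n, ⟨t, b, ht, hb, hl, rfl⟩⟩ := P
  obtain ⟨n', ⟨t', b', ht', hb', hl', rfl⟩⟩ := Q
  obtain rfl : t = t' := h1
  obtain rfl : b = b' := h2
  rfl

/-- The colored Frobenius partition whose entries of color `j` are the one-colored array `x j`.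
Its rows have equal length because the charges add up to `0`. -/
def ofArrays {k : ℕ} (x : {x : Fin k → Finset ℕ × Finset ℕ // ∑ j, charge (x j) = 0}) :
    Σ n, ColoredFPartition k n :=
  ⟨_, row fun j => (x.1 j).1, row fun j => (x.1 j).2, pairwise_row _, pairwise_row _, by
    have h := x.2
    simp only [charge, Finset.sum_sub_distrib, sub_eq_zero] at h
    rw [length_row, length_row]
    exact_mod_cast h, rfl⟩

theorem ofArrays_bijective {k : ℕ} : Function.Bijective (ofArrays (k := k)) := by
  constructor
  · intro x y h
    have h1 := row_injective (congrArg (fun P : Σ n, ColoredFPartition k n => P.2.top) h)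
    have h2 := row_injective (congrArg (fun P : Σ n, ColoredFPartition k n => P.2.bot) h)
    exact Subtype.ext (funext fun j => Prod.ext (congrFun h1 j) (congrFun h2 j))
  · rintro ⟨n, P⟩
    obtain ⟨S, hS⟩ := exists_row_eq P.top_decreasing
    obtain ⟨T, hT⟩ := exists_row_eq P.bot_decreasing
    refine ⟨⟨fun j => (S j, T j), ?_⟩, sigma_coloredFPartition_ext hS hT⟩
    have h := P.length_eq
    rw [← hS, ← hT, length_row, length_row] at h
    simp only [charge, Finset.sum_sub_distrib, sub_eq_zero]
    exact_mod_cast h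

theorem pow_size_ofArrays (q : ℂ) {k : ℕ}
    (x : {x : Fin k → Finset ℕ × Finset ℕ // ∑ j, charge (x j) = 0}) :
    q ^ (ofArrays x).1 = ∏ j, rowWeight q (x.1 j) := by
  have h (S : Fin k → Finset ℕ) : ∏ j, ∏ n ∈ S j, q ^ n = q ^ ∑ j, ∑ n ∈ S j, n := by
    rw [← Finset.prod_pow_eq_pow_sum]
    exact Finset.prod_congr rfl fun j _ => Finset.prod_pow_eq_pow_sum (S j) (fun n => n) q
  simp only [ofArrays, length_row, sum_val_row, rowWeight, Finset.prod_mul_distrib, h,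
    Finset.prod_pow_eq_pow_sum Finset.univ, pow_add, mul_assoc]

/-- The generating function of `cφ_k` as a sum over the charges of the `k` colors. -/
theorem exists_hasSum_cphi {q : ℂ} (hq : ‖q‖ < 1) (k : ℕ) : ∃ a,
    HasSum (fun n : ℕ => (cphi k n : ℂ) * q ^ n) a ∧
    HasSum (fun c : Fin k → ℤ => if ∑ j, c j = 0 then ∏ j, chargeSeries q (c j) else 0) a := by
  have hw := (hasSum_pi_fin_prod (n := k) fun _ => summable_norm_rowWeight hq).1
  have hs := (summable_norm_ite hw fun x => ∑ j, charge (x j) = 0).of_norm.hasSum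
  refine ⟨_, ?_, (hasSum_tsum_ite_fiber hs fun x j => charge (x j)).congr_fun fun c => ?_⟩
  · have h1 : HasSum (fun P : Σ n, ColoredFPartition k n => q ^ P.1) (∑' x : Fin k → _,
        if ∑ j, charge (x j) = 0 then ∏ j, rowWeight q (x j) else 0) := by
      rw [← (Equiv.ofBijective _ ofArrays_bijective).hasSum_iff]
      refine (hasSum_subtype_iff_indicator (f := fun x : Fin k → _ => ∏ j, rowWeight q (x j))
        (s := {x | ∑ j, charge (x j) = 0}).mpr (hs.congr_fun fun x => ?_)).congr_fun fun x =>
        pow_size_ofArrays q x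
      simp [Set.indicator]
    refine h1.sigma fun n => ?_
    have := Fintype.ofFinite (ColoredFPartition k n)
    convert hasSum_fintype fun _ : ColoredFPartition k n => q ^ n using 1
    simp [cphi, Nat.card_eq_fintype_card]
  · split_ifs with hc
    · have h := (hasSum_pi_fin_prod fun j : Fin k =>
        summable_norm_ite (summable_norm_rowWeight hq) fun x => charge x = c j).2.tsum_eq
      rw [Finset.prod_congr rfl fun j _ => chargeSeries.eq_1 q (c j), ← h]
      refine tsum_congr fun x => ?_
      by_cases hx : (fun j => charge (x j)) = c
      · subst hx
        simp [hc]
      · obtain ⟨j, hj⟩ := Function.ne_iff.mp hx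
        rw [if_neg hx]
        exact Finset.prod_eq_zero (Finset.mem_univ j) (if_neg hj)
    · refine ((tsum_congr fun x => ?_).trans tsum_zero).symm
      split_ifs with h1 h2
      · exact absurd (by rw [← h1]; exact h2) hc
      all_goals rfl

/-! ### The generating function of `cφ₆` -/

theorem qpow_div_eta_pow (τ : ℂ) :
    qpow (1 / 4) τ / ModularForm.eta τ ^ 6 = ((∏' n : ℕ, (1 - qpow 1 τ ^ (n + 1))) ^ 6)⁻¹ := by
  have h1 : Function.Periodic.qParam 1 τ = qpow 1 τ := by simp [Function.Periodic.qParam, qpow]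
  have h24 : Function.Periodic.qParam 24 τ ^ 6 = qpow (1 / 4) τ := by
    rw [Function.Periodic.qParam, qpow, ← Complex.exp_nat_mul]
    congr 1
    push_cast
    ring
  have h0 : qpow (1 / 4) τ ≠ 0 := Complex.exp_ne_zero _
  simp only [ModularForm.eta, ModularForm.eta_q, h1, mul_pow, h24]
  rw [div_mul_eq_div_div, div_self h0, one_div]

theorem chargeSeries_qpow {τ : ℂ} (hτ : 0 < τ.im) (c : ℤ) :
    chargeSeries (qpow 1 τ) c = qpow ((c : ℚ) ^ 2 / 2) τ * qpow ((c : ℚ) / 2) τ *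
      (∏' n : ℕ, (1 - qpow 1 τ ^ (n + 1)))⁻¹ := by
  rw [chargeSeries_eq (norm_qpow_one_lt hτ) (Complex.exp_ne_zero _), qpow_one_zpow, ← qpow_add]
  congr 2
  rw [Int.cast_div (Int.even_mul_succ_self c).two_dvd (by norm_num)]
  push_cast
  ring

/-- On the lattice `∑ c = 0` the linear parts of the exponents `c(c+1)/2` cancel. -/
theorem prod_chargeSeries {τ : ℂ} (hτ : 0 < τ.im) {k : ℕ} {c : Fin k → ℤ} (hc : ∑ j, c j = 0) :
    ∏ j, chargeSeries (qpow 1 τ) (c j) =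
      ((∏' n : ℕ, (1 - qpow 1 τ ^ (n + 1))) ^ k)⁻¹ * ∏ j, qpow ((c j : ℚ) ^ 2 / 2) τ := by
  have h : ∏ j, qpow ((c j : ℚ) / 2) τ = 1 := by
    rw [prod_qpow, ← Finset.sum_div, ← Int.cast_sum, hc, Int.cast_zero, zero_div, qpow_zero]
  simp only [chargeSeries_qpow hτ, Finset.prod_mul_distrib, h, mul_one, Finset.prod_const,
    Finset.card_univ, Fintype.card_fin, inv_pow]
  exact mul_comm _ _

end FPartition

theorem proposition4p1 (τ : ℂ) (hτ : 0 < τ.im) :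
    HasSum (fun n : ℕ => (FPartition.cphi 6 n : ℂ) * FPartition.qpow 1 τ ^ n)
      (FPartition.qpow (1 / 4) τ / ModularForm.eta τ ^ 6 *
        (6 * FPartition.theta 1 1 τ ^ 2 * FPartition.theta 1 0 τ *
            FPartition.theta 2 1 (3 * τ) * FPartition.theta 2 1 τ
          + FPartition.theta 1 0 τ ^ 3 *
            (FPartition.theta 1 1 (6 * τ) * FPartition.theta 1 1 (2 * τ)
              + FPartition.theta 1 0 (6 * τ) * FPartition.theta 1 0 (2 * τ)))) := by
  have hq := FPartition.norm_qpow_one_lt hτ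
  obtain ⟨a, h1, h2⟩ := FPartition.exists_hasSum_cphi hq 6
  have hP := pow_ne_zero 6 (FPartition.tprod_one_sub_pow_ne_zero hq)
  have h3 := FPartition.latticeSum_eq hτ <| ((h2.mul_left
    ((∏' n : ℕ, (1 - FPartition.qpow 1 τ ^ (n + 1))) ^ 6)).congr_fun fun c => ?_)
  · rw [FPartition.qpow_div_eta_pow, ← h3, inv_mul_cancel_left₀ hP]
    exact h1
  · split_ifs with hc
    · rw [FPartition.prod_chargeSeries hτ hc, mul_inv_cancel_left₀ hP]
    · rw [mul_zero]
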